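/- Let $\mathbf{k}$ be a commutative ring. A weak composition is a sequence $\alpha=(\alpha_1,\alpha_2,\alpha_3,\ldots)$ of nonnegative integers of which all but finitely many are $0$; we set $|\alpha|=\sum_i\alpha_i$ and $\mathbf{x}^\alpha=x_1^{\alpha_1}x_2^{\alpha_2}x_3^{\alpha_3}\cdots$. A partition is a weakly decreasing weak composition. For a partition $\lambda$, let $s_\lambda\in\mathbf{k}[[x_1,x_2,x_3,\ldots]]$ be the Schur function $s_\lambda=\sum_T\mathbf{x}_T$, where $T$ ranges over all semistandard tableaux of shape $\lambda$ and $\mathbf{x}_T$ is the product of the $x_i$ over all entries $i$ of $T$. For a positive integer $k$ and a nonnegative integer $m$, define the formal power series $$G(k)=\sum_{\substack{\alpha\text{ weak composition};\\ \alpha_i<k\text{ for all }i}}\mathbf{x}^\alpha,\qquad G(k,m)=\sum_{\substack{\alpha\text{ weak composition};\\ |\alpha|=m;\ \alpha_i<k\text{ for all }i}}\mathbf{x}^\alpha .$$ For partitions $\lambda$ and $\mu$, let $$\operatorname{pet}_k(\lambda,\mu)=\det\bigl([0\le\lambda_i-\mu_j-i+j<k]\bigr)_{1\le i,j\le\ell}\in\mathbb{Z},$$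 where $[\mathcal{A}]$ is $1$ if $\mathcal{A}$ is true and $0$ otherwise, and where $\ell$ is such that $\lambda_i=\mu_i=0$ for all $i>\ell$ (the value does not depend on the choice of $\ell$). Theorem. For every positive integer $k$ and every partition $\mu$, $$G(k)\cdot s_\mu=\sum_{\lambda\text{ partition}}\operatorname{pet}_k(\lambda,\mu)\,s_\lambda ,$$ where the infinite sum is understood coefficientwise (for each monomial, only finitely many addends contribute to its coefficient). Moreover, for every nonnegative integer $m$, $$G(k,m)\cdot s_\mu=\sum_{\lambda\text{ partition};\ |\lambda|=m+|\mu|}\operatorname{pet}_k(\lambda,\mu)\,s_\lambda .$$ -/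

import Mathlib

open scoped MvPowerSeries.WithPiTopology

/-!
Partitions are represented by Mathlib's `YoungDiagram`: with 0-based indices, the `(i+1)`-st part
of `lam` is `lam.rowLen i` (which is `0` for large `i`), the size `|lam|` is `lam.card`, and the
number of nonzero parts is `lam.colLen 0`.  The variables `x₁, x₂, x₃, …` are indexed by `ℕ`
(`x_{i+1}` is `MvPowerSeries.X i`), weak compositions are the elements of `ℕ →₀ ℕ`, and
a power series in `R[[x₁, x₂, x₃, …]]` is an `MvPowerSeries ℕ R`, that is, the function sending
an exponent vector to its coefficient.
-/

namespace Petrie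

/-- There are only finitely many partitions of a given size. -/
theorem finite_partitions (n : ℕ) : {lam : YoungDiagram | lam.card = n}.Finite := by
  have hinj : Function.Injective YoungDiagram.cells := fun a b h => YoungDiagram.ext h
  refine Set.Finite.of_finite_image (f := YoungDiagram.cells) ?_ hinj.injOn
  refine Set.Finite.subset
    (Finset.finite_toSet (Finset.range n ×ˢ Finset.range n).powerset) ?_
  rintro _ ⟨lam, hlam, rfl⟩
  simp only [Finset.mem_coe, Finset.mem_powerset]
  rintro ⟨i, j⟩ hij
  rw [YoungDiagram.mem_cells] at hij
  have h1 : (Finset.range (i + 1)).card ≤ lam.cells.card := by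
    refine Finset.card_le_card_of_injOn (fun a => (a, j)) ?_ ?_
    · intro a ha
      have ha' : a < i + 1 := by simpa using ha
      exact lam.mem_cells _ |>.2 (lam.up_left_mem (by omega) le_rfl hij)
    · intro a _ b _ h
      exact (Prod.ext_iff.1 h).1
  have h2 : (Finset.range (j + 1)).card ≤ lam.cells.card := by
    refine Finset.card_le_card_of_injOn (fun a => (i, a)) ?_ ?_
    · intro a ha
      have ha' : a < j + 1 := by simpa using ha
      exact lam.mem_cells _ |>.2 (lam.up_left_mem le_rfl (by omega) hij)
    · intro a _ b _ h
      exact (Prod.ext_iff.1 h).2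
  have h3 : lam.cells.card = n := hlam
  simp only [Finset.card_range] at h1 h2
  simp only [Finset.mem_product, Finset.mem_range]
  omega

/-- The finite set of all partitions of size `n`. -/
noncomputable def partitionsOfSize (n : ℕ) : Finset YoungDiagram :=
  (finite_partitions n).toFinset

theorem mem_partitionsOfSize (n : ℕ) (lam : YoungDiagram) :
    lam ∈ partitionsOfSize n ↔ lam.card = n := by
  simp [partitionsOfSize]

/-- The Petrie symmetric series `G(k)`: the sum of all monomials `x^α` all of whose exponents
`α_i` are less than `k`. -/
noncomputable def petrieSeries (R : Type*) [CommRing R] (k : ℕ) : MvPowerSeries ℕ R :=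
  open Classical in fun α => if ∀ i, α i < k then 1 else 0

/-- The Petrie symmetric function `G(k, m)`: the sum of all monomials `x^α` of degree `m` all of
whose exponents `α_i` are less than `k`. -/
noncomputable def petrieFunction (R : Type*) [CommRing R] (k m : ℕ) : MvPowerSeries ℕ R :=
  open Classical in fun α => if α.degree = m ∧ ∀ i, α i < k then 1 else 0

/-- The exponent vector of the monomial `x_T`, the product of the variables `x_i` over all
entries `i` of the semistandard tableau `T`. -/
noncomputable def content {lam : YoungDiagram} (T : SemistandardYoungTableau lam) : ℕ →₀ ℕ :=
  ∑ c ∈ lam.cells, Finsupp.single (T c.1 c.2) 1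

/-- Only finitely many semistandard tableaux `T` of a given shape have a given monomial `x_T`. -/
theorem finite_content_eq (lam : YoungDiagram) (α : ℕ →₀ ℕ) :
    Finite {T : SemistandardYoungTableau lam // content T = α} := by
  have key : ∀ T : {T : SemistandardYoungTableau lam // content T = α},
      ∀ c : lam.cells, T.1 c.1.1 c.1.2 ∈ α.support := by
    rintro ⟨T, rfl⟩ ⟨c, hc⟩
    rw [Finsupp.mem_support_iff]
    intro h
    unfold content at h
    rw [Finsupp.finsetSum_apply, Finset.sum_eq_zero_iff] at h
    simpa using h c hc
  refine Finite.of_injective (β := lam.cells → α.support)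
    (fun T c => ⟨T.1 c.1.1 c.1.2, key T c⟩) ?_
  intro T T' h
  apply Subtype.ext
  apply SemistandardYoungTableau.ext
  intro i j
  by_cases hij : (i, j) ∈ lam
  · have := congrFun h ⟨(i, j), (lam.mem_cells _).2 hij⟩
    exact congrArg Subtype.val this
  · rw [T.1.zeros hij, T'.1.zeros hij]

/-- The Schur function `s_lam = ∑ x_T`, the sum over all semistandard tableaux `T` of shape `lam`:
the coefficient of `x^α` is the number of those `T` with `x_T = x^α`. -/
noncomputable def schur (R : Type*) [CommRing R] (lam : YoungDiagram) : MvPowerSeries ℕ R :=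
  fun α => (Nat.card {T : SemistandardYoungTableau lam // content T = α} : R)

/-- The `ℓ × ℓ` matrix with entries `[0 ≤ lam_i - mu_j - i + j < k]`. -/
def petrieMatrix (k : ℕ) (lam mu : YoungDiagram) (ℓ : ℕ) : Matrix (Fin ℓ) (Fin ℓ) ℤ :=
  fun i j =>
    if 0 ≤ (lam.rowLen i : ℤ) - mu.rowLen j - (i : ℕ) + (j : ℕ) ∧
        (lam.rowLen i : ℤ) - mu.rowLen j - (i : ℕ) + (j : ℕ) < k then 1 else 0

/-- The `k`-Petrie number `pet_k(lam, mu)`: the determinant of `petrieMatrix k lam mu ℓ` where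
`ℓ` is the larger one of the numbers of nonzero parts of `lam` and `mu`.  By
`petrieNumber_eq_det`, every larger `ℓ` gives the same value. -/
def petrieNumber (k : ℕ) (lam mu : YoungDiagram) : ℤ :=
  (petrieMatrix k lam mu (max (lam.colLen 0) (mu.colLen 0))).det

theorem rowLen_eq_zero (lam : YoungDiagram) {i : ℕ} (h : lam.colLen 0 ≤ i) :
    lam.rowLen i = 0 := by
  by_contra h0
  have h1 : (i, 0) ∈ lam := YoungDiagram.mem_iff_lt_rowLen.2 (Nat.pos_of_ne_zero h0)
  have h2 := YoungDiagram.mem_iff_lt_colLen.1 h1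
  omega

/-- The Petrie number may be computed with any `ℓ` for which `lam` and `mu` both have at most `ℓ`
nonzero parts. -/
theorem petrieNumber_eq_det (k : ℕ) (hk : 0 < k) (lam mu : YoungDiagram) (ℓ : ℕ)
    (hl : lam.colLen 0 ≤ ℓ) (hm : mu.colLen 0 ≤ ℓ) :
    petrieNumber k lam mu = (petrieMatrix k lam mu ℓ).det := by
  induction ℓ, (max_le hl hm) using Nat.le_induction with
  | base => rfl
  | succ n hn ih =>
    have hl' := (le_max_left _ _).trans hn
    have hm' := (le_max_right _ _).trans hn
    have el := rowLen_eq_zero lam hl'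
    have em := rowLen_eq_zero mu hm'
    rw [ih hl' hm', Matrix.det_succ_row _ (Fin.last n), Fin.sum_univ_castSucc,
      Finset.sum_eq_zero, zero_add]
    · have h1 : petrieMatrix k lam mu (n + 1) (Fin.last n) (Fin.last n) = 1 := by
        simp [petrieMatrix, el, em, hk]
      have h2 : (petrieMatrix k lam mu (n + 1)).submatrix (Fin.last n).succAbove
          (Fin.last n).succAbove = petrieMatrix k lam mu n := by
        ext i j
        simp [petrieMatrix]
      rw [h1, h2]
      simp [← two_mul, pow_mul]
    · intro j _
      have h1 : petrieMatrix k lam mu (n + 1) (Fin.last n) j.castSucc = 0 := by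
        have hj := j.isLt
        simp only [petrieMatrix, Fin.val_last, Fin.val_castSucc, el]
        rw [if_neg]
        omega
      simp [h1]

end Petrie

/-! Everything is reduced to finitely many variables, where Schur polynomials are ratios of
alternants. Write a_l = det(x_i^(l_j)) in N variables. The bialternant formula
`tableauSum_mul_alternant` says that s_lam times the Vandermonde determinant is a_l, where l lists
the parts of lam plus a staircase. It is proved by induction on N: deleting the largest entry from
tableaux (`tableauSum_succ`) and eliminating the last variable from alternants (`alternant_succ`)
give the same recursion over interlacing partitions, up to the factor by which the Vandermonde
determinant itself grows.

In N variables G(k) becomes the product of the sums 1 + x_i + ... + x_i^(k-1). Multiplying row i of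
an alternant a_m by the i-th factor replaces x_i^(m_j) by the sum of x_i^a over m_j ≤ a < m_j + k.
Expanding by columns and sorting exponents, the coefficient of a_l is det([m_j ≤ l_i < m_j + k])
(`petriePoly_mul_alternant`), which for shifted partitions is the Petrie number. Cancelling the
Vandermonde determinant gives the theorem in N variables. Any single coefficient is already visible
for N large, and homogeneity of Schur functions then yields both claims. -/

namespace Petrie

/-! ### Schur polynomials in finitely many variables -/

/-- The semistandard tableaux of shape `lam` with all entries less than `N`. -/
abbrev BoundedTableau (N : ℕ) (lam : YoungDiagram) : Type :=
  {T : SemistandardYoungTableau lam // ∀ i j, (i, j) ∈ lam → T i j < N}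

instance (N : ℕ) (lam : YoungDiagram) : Finite (BoundedTableau N lam) := by
  refine Finite.of_injective (β := lam.cells → Fin N)
    (fun T c => ⟨T.1 c.1.1 c.1.2, T.2 _ _ ((lam.mem_cells _).1 c.2)⟩) ?_
  intro T T' h
  apply Subtype.ext
  apply SemistandardYoungTableau.ext
  intro i j
  by_cases hij : (i, j) ∈ lam
  · exact congrArg Fin.val (congrFun h ⟨(i, j), (lam.mem_cells _).2 hij⟩)
  · rw [T.1.zeros hij, T'.1.zeros hij]

noncomputable instance (N : ℕ) (lam : YoungDiagram) : Fintype (BoundedTableau N lam) :=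
  Fintype.ofFinite _

/-- The Schur polynomial in the first `N` variables. -/
noncomputable def tableauSum (N : ℕ) (lam : YoungDiagram) : MvPolynomial ℕ ℤ :=
  ∑ T : BoundedTableau N lam, MvPolynomial.monomial (content T.1) 1

theorem entry_lt_of_content_support {lam : YoungDiagram} (T : SemistandardYoungTableau lam)
    {N : ℕ} (h : (content T).support ⊆ Finset.range N) (i j : ℕ) (hij : (i, j) ∈ lam) :
    T i j < N := by
  rw [← Finset.mem_range]
  apply h
  rw [Finsupp.mem_support_iff]
  intro h0
  unfold content at h0
  rw [Finsupp.finsetSum_apply, Finset.sum_eq_zero_iff] at h0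
  simpa using h0 (i, j) ((lam.mem_cells _).2 hij)

/-- Every entry of a tableau occurs in its content, so once `N` exceeds all indices in the support
of `α`, the bound on the entries is automatic. -/
theorem coeff_tableauSum {N : ℕ} (lam : YoungDiagram) {α : ℕ →₀ ℕ}
    (hα : α.support ⊆ Finset.range N) :
    (tableauSum N lam).coeff α =
      (Nat.card {T : SemistandardYoungTableau lam // content T = α} : ℤ) := by
  classical
  simp only [tableauSum, MvPolynomial.coeff_sum, MvPolynomial.coeff_monomial]
  rw [Finset.sum_boole, ← Fintype.card_subtype, ← Nat.card_eq_fintype_card]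
  congr 1
  refine Nat.card_congr
    ⟨fun T => ⟨T.1.1, T.2⟩, fun T => ⟨⟨T.1, ?_⟩, T.2⟩, fun _ => rfl, fun _ => rfl⟩
  apply entry_lt_of_content_support
  rwa [T.2]

theorem degree_content {lam : YoungDiagram} (T : SemistandardYoungTableau lam) :
    (content T).degree = lam.card := by
  simp [content, YoungDiagram.card]

theorem row_le_entry {lam : YoungDiagram} (T : SemistandardYoungTableau lam) {i j : ℕ}
    (h : (i, j) ∈ lam) : i ≤ T i j := by
  induction i with
  | zero => omega
  | succ i ih =>
    have := ih (lam.up_left_mem (Nat.le_succ i) le_rfl h)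
    have := T.col_strict (Nat.lt_add_one i) h
    omega

theorem card_eq_sum_rowLen (lam : YoungDiagram) {N : ℕ} (h : lam.colLen 0 ≤ N) :
    lam.card = ∑ i ∈ Finset.range N, lam.rowLen i := by
  unfold YoungDiagram.card
  rw [Finset.card_eq_sum_card_fiberwise (f := Prod.fst) (t := Finset.range N)]
  · refine Finset.sum_congr rfl fun i _ => ?_
    rw [YoungDiagram.rowLen_eq_card]
    rfl
  · rintro ⟨i, j⟩ hc
    have h1 : (i, 0) ∈ lam := lam.up_left_mem le_rfl (Nat.zero_le j) ((lam.mem_cells _).1 hc)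
    have := YoungDiagram.mem_iff_lt_colLen.1 h1
    simp
    omega

theorem eq_of_rowLen_eq {lam nu : YoungDiagram} (h : ∀ i, lam.rowLen i = nu.rowLen i) :
    lam = nu := by
  refine SetLike.ext ?_
  rintro ⟨i, j⟩
  rw [YoungDiagram.mem_iff_lt_rowLen, YoungDiagram.mem_iff_lt_rowLen, h]

/-! ### Branching: removing the largest entry of a tableau -/

/-- The partitions `nu` with at most `N` parts which interlace with `lam`, that is, such that
`lam / nu` is a horizontal strip. -/
def interlacing (N : ℕ) (lam : YoungDiagram) : Set YoungDiagram :=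
  {nu | nu.colLen 0 ≤ N ∧ ∀ i, lam.rowLen (i + 1) ≤ nu.rowLen i ∧ nu.rowLen i ≤ lam.rowLen i}

theorem le_of_mem_interlacing {N : ℕ} {lam nu : YoungDiagram} (h : nu ∈ interlacing N lam) :
    nu ≤ lam := by
  rintro ⟨i, j⟩ hc
  have hc' : (i, j) ∈ nu := hc
  change (i, j) ∈ lam
  rw [YoungDiagram.mem_iff_lt_rowLen] at hc' ⊢
  exact hc'.trans_le (h.2 i).2

theorem finite_interlacing (N : ℕ) (lam : YoungDiagram) : (interlacing N lam).Finite := by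
  have hinj : Function.Injective YoungDiagram.cells := fun a b h => YoungDiagram.ext h
  refine Set.Finite.of_finite_image (f := YoungDiagram.cells) ?_ hinj.injOn
  refine Set.Finite.subset (Finset.finite_toSet lam.cells.powerset) ?_
  rintro _ ⟨nu, hnu, rfl⟩
  simpa using le_of_mem_interlacing hnu

/-- The partitions interlacing with `lam`, as a finite set. -/
noncomputable def interlacingFinset (N : ℕ) (lam : YoungDiagram) : Finset YoungDiagram :=
  (finite_interlacing N lam).toFinset

theorem mem_interlacingFinset {N : ℕ} {lam nu : YoungDiagram} :
    nu ∈ interlacingFinset N lam ↔ nu ∈ interlacing N lam := by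
  simp [interlacingFinset]

/-- The shape formed by the entries less than `N` of a semistandard tableau. -/
def subshape {lam : YoungDiagram} (T : SemistandardYoungTableau lam) (N : ℕ) : YoungDiagram where
  cells := lam.cells.filter fun c => T c.1 c.2 < N
  isLowerSet := by
    rintro ⟨i, j⟩ ⟨i', j'⟩ h hc
    obtain ⟨hi, hj⟩ := Prod.mk_le_mk.1 h
    simp only [Finset.coe_filter, YoungDiagram.mem_cells, Set.mem_ofPred_eq] at hc ⊢
    refine ⟨lam.up_left_mem hi hj hc.1, ?_⟩
    have h1 := T.row_weak_of_le hj hc.1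
    have h2 := T.col_weak hi (lam.up_left_mem le_rfl hj hc.1)
    omega

theorem mem_subshape {lam : YoungDiagram} (T : SemistandardYoungTableau lam) (N i j : ℕ) :
    (i, j) ∈ subshape T N ↔ (i, j) ∈ lam ∧ T i j < N := by
  change (i, j) ∈ lam.cells.filter _ ↔ _
  simp

/-- Columns increase strictly and entries are at most `N`, so a cell with another cell below it
holds an entry less than `N`. The bound on the number of rows comes from `row_le_entry`. -/
theorem subshape_mem_interlacing {N : ℕ} {lam : YoungDiagram} (T : BoundedTableau (N + 1) lam) :
    subshape T.1 N ∈ interlacing N lam := by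
  refine ⟨?_, fun i => ⟨?_, ?_⟩⟩
  · by_contra! h
    obtain ⟨h1, h2⟩ := (mem_subshape _ _ _ _).1 (YoungDiagram.mem_iff_lt_colLen.2 h)
    have := row_le_entry T.1 h1
    omega
  · by_contra! h
    have h1 := YoungDiagram.mem_iff_lt_rowLen.2 h
    have h2 : (i, (subshape T.1 N).rowLen i) ∉ subshape T.1 N := by
      simp [YoungDiagram.mem_iff_lt_rowLen]
    rw [mem_subshape] at h2
    have h3 := T.1.col_strict (Nat.lt_add_one i) h1
    have h4 := T.2 _ _ h1
    exact h2 ⟨lam.up_left_mem (Nat.le_succ i) le_rfl h1, by omega⟩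
  · by_contra! h
    have h1 := ((mem_subshape _ _ _ _).1 (YoungDiagram.mem_iff_lt_rowLen.2 h)).1
    simp [YoungDiagram.mem_iff_lt_rowLen] at h1

/-- A horizontal strip has at most one cell per column. This keeps columns strict when the strip is
filled with a constant. -/
theorem mem_of_row_lt {N : ℕ} {lam nu : YoungDiagram} (h : nu ∈ interlacing N lam)
    {i i' j : ℕ} (hi : i < i') (hc : (i', j) ∈ lam) : (i, j) ∈ nu := by
  have h1 := YoungDiagram.mem_iff_lt_rowLen.1 (lam.up_left_mem (Nat.succ_le_of_lt hi) le_rfl hc)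
  rw [YoungDiagram.mem_iff_lt_rowLen]
  exact h1.trans_le (h.2 i).1

/-- Extend a tableau of shape `nu` with entries less than `N` to one of shape `lam`, by filling
the additional cells with `N`. -/
def extend {N : ℕ} {lam nu : YoungDiagram} (h : nu ∈ interlacing N lam)
    (T : BoundedTableau N nu) : BoundedTableau (N + 1) lam :=
  ⟨{ entry := fun i j => if (i, j) ∈ nu then T.1 i j else if (i, j) ∈ lam then N else 0
     row_weak' := by
      intro i j1 j2 hj hc
      have h1 := lam.up_left_mem le_rfl hj.le hc
      by_cases h2 : (i, j2) ∈ nu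
      · simpa [h2, nu.up_left_mem le_rfl hj.le h2] using T.1.row_weak hj h2
      · by_cases h3 : (i, j1) ∈ nu
        · simpa [h2, h3, hc] using (T.2 _ _ h3).le
        · simp [h2, h3, h1, hc]
     col_strict' := by
      intro i1 i2 j hi hc
      have h1 := mem_of_row_lt h hi hc
      by_cases h2 : (i2, j) ∈ nu
      · simpa [h2, h1] using T.1.col_strict hi h2
      · simpa [h2, h1, hc] using T.2 _ _ h1
     zeros' := by
      intro i j hc
      have h1 : (i, j) ∉ nu := fun h' => hc (le_of_mem_interlacing h h')
      simp [h1, hc] }, by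
    intro i j hc
    change (if (i, j) ∈ nu then T.1 i j else if (i, j) ∈ lam then N else 0) < _
    split_ifs with h1
    · exact (T.2 _ _ h1).trans (Nat.lt_succ_self N)
    · exact Nat.lt_succ_self N⟩

theorem extend_apply {N : ℕ} {lam nu : YoungDiagram} (h : nu ∈ interlacing N lam)
    (T : BoundedTableau N nu) (i j : ℕ) :
    (extend h T).1 i j = if (i, j) ∈ nu then T.1 i j else if (i, j) ∈ lam then N else 0 := rfl

theorem subshape_extend {N : ℕ} {lam nu : YoungDiagram} (h : nu ∈ interlacing N lam)
    (T : BoundedTableau N nu) : subshape (extend h T).1 N = nu := by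
  refine SetLike.ext ?_
  rintro ⟨i, j⟩
  rw [mem_subshape, extend_apply]
  by_cases h1 : (i, j) ∈ nu
  · simpa [h1, T.2 _ _ h1] using le_of_mem_interlacing h h1
  · simp only [h1, if_false, iff_false, not_and]
    intro h2
    simp [h2]

theorem extend_injective {N : ℕ} {lam nu : YoungDiagram} (h : nu ∈ interlacing N lam) :
    Function.Injective (extend h) := by
  intro T T' hT
  apply Subtype.ext
  apply SemistandardYoungTableau.ext
  intro i j
  by_cases hij : (i, j) ∈ nu
  · have h1 : (extend h T).1 i j = (extend h T').1 i j := by rw [hT]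
    simpa [extend_apply, hij] using h1
  · rw [T.1.zeros hij, T'.1.zeros hij]

theorem exists_extend_eq {N : ℕ} {lam : YoungDiagram} (T : BoundedTableau (N + 1) lam) :
    ∃ T', extend (subshape_mem_interlacing T) T' = T := by
  have hm := mem_subshape T.1 N
  refine ⟨⟨{ entry := fun i j => if (i, j) ∈ subshape T.1 N then T.1 i j else 0
             row_weak' := ?_, col_strict' := ?_, zeros' := ?_ }, ?_⟩, ?_⟩
  · intro i j1 j2 hj hc
    simpa [hc, (subshape T.1 N).up_left_mem le_rfl hj.le hc] using
      T.1.row_weak hj ((hm _ _).1 hc).1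
  · intro i1 i2 j hi hc
    simpa [hc, (subshape T.1 N).up_left_mem hi.le le_rfl hc] using
      T.1.col_strict hi ((hm _ _).1 hc).1
  · intro i j hc
    simp [hc]
  · intro i j hc
    change (if (i, j) ∈ subshape T.1 N then T.1 i j else 0) < N
    rw [if_pos hc]
    exact ((hm _ _).1 hc).2
  · apply Subtype.ext
    apply SemistandardYoungTableau.ext
    intro i j
    rw [extend_apply]
    change (if (i, j) ∈ subshape T.1 N then (if (i, j) ∈ subshape T.1 N then T.1 i j else 0)
      else if (i, j) ∈ lam then N else 0) = _
    split_ifs with h1 h2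
    · rfl
    · have h3 := T.2 _ _ h2
      rw [hm] at h1
      have h4 : ¬ T.1 i j < N := fun h => h1 ⟨h2, h⟩
      omega
    · exact (T.1.zeros h2).symm

theorem content_extend {N : ℕ} {lam nu : YoungDiagram} (h : nu ∈ interlacing N lam)
    (T : BoundedTableau N nu) :
    content (extend h T).1 = content T.1 + Finsupp.single N (lam.card - nu.card) := by
  have hsub : nu.cells ⊆ lam.cells := le_of_mem_interlacing h
  unfold content
  rw [← Finset.sum_sdiff hsub, add_comm]
  congr 1
  · refine Finset.sum_congr rfl ?_
    rintro ⟨i, j⟩ hc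
    rw [extend_apply, if_pos ((nu.mem_cells _).1 hc)]
  · rw [Finset.sum_congr rfl (g := fun _ => Finsupp.single N 1)]
    · simp [Finset.card_sdiff_of_subset hsub, YoungDiagram.card]
    · rintro ⟨i, j⟩ hc
      simp only [Finset.mem_sdiff, YoungDiagram.mem_cells] at hc
      rw [extend_apply, if_neg hc.2, if_pos hc.1]

/-- The branching rule for Schur polynomials. -/
theorem tableauSum_succ (N : ℕ) (lam : YoungDiagram) :
    tableauSum (N + 1) lam = ∑ nu ∈ interlacingFinset N lam,
      tableauSum N nu * MvPolynomial.X N ^ (lam.card - nu.card) := by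
  classical
  unfold tableauSum
  rw [← Finset.sum_fiberwise_of_maps_to (s := Finset.univ) (t := interlacingFinset N lam)
    (g := fun T : BoundedTableau (N + 1) lam => subshape T.1 N)
    (fun T _ => mem_interlacingFinset.2 (subshape_mem_interlacing T))]
  refine Finset.sum_congr rfl fun nu hnu => ?_
  rw [mem_interlacingFinset] at hnu
  rw [Finset.sum_mul]
  symm
  refine Finset.sum_bij (fun T _ => extend hnu T) ?_ ?_ ?_ ?_
  · intro T _
    simp [subshape_extend]
  · intro T _ T' _ h
    exact extend_injective hnu h
  · intro T hT
    have hT' : subshape T.1 N = nu := by simpa using hT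
    subst hT'
    obtain ⟨T', h⟩ := exists_extend_eq T
    exact ⟨T', Finset.mem_univ _, h⟩
  · intro T _
    rw [content_extend, MvPolynomial.monomial_add_single]

theorem tableauSum_zero (lam : YoungDiagram) (h : lam.colLen 0 ≤ 0) : tableauSum 0 lam = 1 := by
  have hl : ∀ i j, (i, j) ∉ lam := by
    intro i j hc
    have h1 := YoungDiagram.mem_iff_lt_colLen.1
      (lam.up_left_mem (Nat.zero_le i) (Nat.zero_le j) hc)
    omega
  have hu : ∀ T T' : BoundedTableau 0 lam, T = T' := by
    intro T T'
    apply Subtype.ext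
    apply SemistandardYoungTableau.ext
    intro i j
    rw [T.1.zeros (hl i j), T'.1.zeros (hl i j)]
  -- The shape is empty, so the bound on the entries is vacuous and any tableau serves.
  have T0 : BoundedTableau 0 lam :=
    ⟨SemistandardYoungTableau.highestWeight lam, fun i j hc => absurd hc (hl i j)⟩
  have hc : content T0.1 = 0 := by
    unfold content
    refine Finset.sum_eq_zero ?_
    rintro ⟨i, j⟩ hc
    exact absurd ((lam.mem_cells _).1 hc) (hl i j)
  unfold tableauSum
  rw [Fintype.sum_eq_single T0 (fun T hT => absurd (hu T T0) hT), hc]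
  rfl

/-! ### Alternants and their branching rule -/

/-- Multilinearity of the determinant in its columns; the transposes are there because
`Matrix.detRowAlternating` is multilinear in rows. -/
theorem det_sum_col {n β A : Type*} [Fintype n] [DecidableEq n] [CommRing A]
    (s : n → Finset β) (c : n → β → A) (v : n → β → A) :
    (Matrix.of fun i j => ∑ a ∈ s j, c j a * v i a).det =
      ∑ f ∈ Fintype.piFinset s,
        (∏ j, c j (f j)) * (Matrix.of fun i j => v i (f j)).det := by
  rw [← Matrix.det_transpose]
  have h1 : (Matrix.of fun i j => ∑ a ∈ s j, c j a * v i a).transpose =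
      (fun j => ∑ a ∈ s j, fun i => c j a * v i a) := by
    ext j i
    simp
  have h2 := (Matrix.detRowAlternating (n := n) (R := A)).toMultilinearMap.map_sum_finset
    (fun j a => fun i => c j a * v i a) s
  rw [h1]
  refine h2.trans (Finset.sum_congr rfl fun f _ => ?_)
  rw [← Matrix.det_mul_row, ← Matrix.det_transpose]
  rfl

/-- The alternant `det (x_i ^ l_j)` in the first `N` variables. -/
noncomputable def alternant (N : ℕ) (l : Fin N → ℕ) : MvPolynomial ℕ ℤ :=
  (Matrix.of fun i j : Fin N => (MvPolynomial.X (i : ℕ) : MvPolynomial ℕ ℤ) ^ l j).det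

open MvPolynomial in
/-- The branching rule for alternants. -/
theorem alternant_succ (N : ℕ) (l : Fin (N + 1) → ℕ) (hl : StrictMono l) :
    alternant (N + 1) l = (∏ i : Fin N, (X N - X (i : ℕ))) *
      ∑ m ∈ Fintype.piFinset (fun j : Fin N => Finset.Ico (l j.castSucc) (l j.succ)),
        alternant N m * X N ^ (l 0 + ∑ j : Fin N, (l j.succ - 1 - m j)) := by
  have key : ∀ (i : ℕ) (j : Fin N), (X i : MvPolynomial ℕ ℤ) ^ l j.succ -
      X N ^ (l j.succ - l j.castSucc) * X i ^ l j.castSucc =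
      (X i - X N) * ∑ a ∈ Finset.Ico (l j.castSucc) (l j.succ),
        X N ^ (l j.succ - 1 - a) * X i ^ a := by
    intro i j
    have h := mul_geom_sum₂_Ico (X i : MvPolynomial ℕ ℤ) (X N)
      (hl (Fin.castSucc_lt_succ (i := j))).le
    simp only [mul_comm (X N ^ _) (X i ^ _)]
    exact h.symm
  -- Column operations: from each column after the first, subtract the multiple of its left
  -- neighbour that kills its entry in the last row. By `key`, row `i` of the new columns is
  -- divisible by `X i - X N`.
  let B : Matrix (Fin (N + 1)) (Fin (N + 1)) (MvPolynomial ℕ ℤ) := Matrix.of fun i j =>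
    Fin.cases (X (i : ℕ) ^ l 0) (fun j => X (i : ℕ) ^ l j.succ -
      X N ^ (l j.succ - l j.castSucc) * X (i : ℕ) ^ l j.castSucc) j
  have hB0 : ∀ i, B i 0 = X (i : ℕ) ^ l 0 := fun i => rfl
  have hBs : ∀ i (j : Fin N), B i j.succ = X (i : ℕ) ^ l j.succ -
      X N ^ (l j.succ - l j.castSucc) * X (i : ℕ) ^ l j.castSucc := fun i j => rfl
  have h1 : alternant (N + 1) l = B.det := by
    refine Matrix.det_eq_of_forall_col_eq_smul_add_pred
      (fun j => X N ^ (l j.succ - l j.castSucc)) (fun i => rfl) fun i j => ?_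
    rw [hBs]
    simp
  have h2 : (B.submatrix Fin.castSucc Fin.succ).det = (∏ i : Fin N, (X (i : ℕ) - X N)) *
      ∑ m ∈ Fintype.piFinset (fun j : Fin N => Finset.Ico (l j.castSucc) (l j.succ)),
        alternant N m * X N ^ (∑ j : Fin N, (l j.succ - 1 - m j)) := by
    have h3 : B.submatrix Fin.castSucc Fin.succ = Matrix.of fun i j : Fin N =>
        (X (i : ℕ) - X N) * (Matrix.of (fun i j : Fin N =>
          ∑ a ∈ Finset.Ico (l j.castSucc) (l j.succ),
            X N ^ (l j.succ - 1 - a) * X (i : ℕ) ^ a)) i j := by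
      ext1 i j
      exact key i j
    rw [h3, Matrix.det_mul_column, det_sum_col _ (fun (j : Fin N) a => X N ^ (l j.succ - 1 - a))
      (fun (i : Fin N) a => X (i : ℕ) ^ a)]
    refine congrArg _ (Finset.sum_congr rfl fun m _ => ?_)
    rw [Finset.prod_pow_eq_pow_sum, mul_comm]
    rfl
  rw [h1, Matrix.det_succ_row B (Fin.last N), Fin.sum_univ_succ, Finset.sum_eq_zero]
  · rw [hB0]
    have h4 : B.submatrix (Fin.last N).succAbove (Fin.succAbove 0) =
        B.submatrix Fin.castSucc Fin.succ := by
      ext1 i j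
      simp
    -- The cofactor sign at position `(N, 0)` is absorbed by reversing the `N` differences.
    have h5 : (∏ i : Fin N, (X N - X (i : ℕ)) : MvPolynomial ℕ ℤ) =
        (-1) ^ N * ∏ i : Fin N, (X (i : ℕ) - X N) := by
      rw [← Fin.prod_const, ← Finset.prod_mul_distrib]
      exact Finset.prod_congr rfl fun i _ => by ring
    rw [h4, h2, h5]
    simp only [pow_add, Finset.mul_sum, add_zero, Fin.val_last, Fin.val_zero]
    exact Finset.sum_congr rfl fun m _ => by ring
  -- In the last row the factor `X i - X N` becomes zero.
  · intro j _
    rw [hBs, Fin.val_last, key]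
    simp

/-- A Vandermonde determinant in distinct variables over a domain; this permits its cancellation
later. -/
theorem alternant_ne_zero (N : ℕ) : alternant N (fun j => (j : ℕ)) ≠ 0 := by
  change (Matrix.vandermonde fun i : Fin N => (MvPolynomial.X (i : ℕ) : MvPolynomial ℕ ℤ)).det ≠ 0
  rw [Matrix.det_vandermonde_ne_zero_iff]
  intro i j h
  exact Fin.ext (MvPolynomial.X_injective h)

/-! ### Partitions as strictly increasing sequences -/

/-- The strictly increasing sequence `lam_N < lam_{N-1} + 1 < ⋯ < lam_1 + N - 1`. -/
def shifted (N : ℕ) (lam : YoungDiagram) : Fin N → ℕ :=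
  fun j => lam.rowLen (N - 1 - j) + j

theorem shifted_strictMono (N : ℕ) (lam : YoungDiagram) : StrictMono (shifted N lam) := by
  intro i j h
  have h' : (i : ℕ) < j := h
  have h1 := lam.rowLen_anti (N - 1 - j) (N - 1 - i) (by omega)
  simp only [shifted]
  omega

theorem shifted_injOn (N : ℕ) :
    Set.InjOn (shifted N) {lam : YoungDiagram | lam.colLen 0 ≤ N} := by
  intro lam hlam nu hnu h
  refine eq_of_rowLen_eq fun i => ?_
  by_cases hi : i < N
  · have h1 := congrFun h ⟨N - 1 - i, by omega⟩
    have h2 : N - 1 - (N - 1 - i) = i := by omega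
    simpa [shifted, h2] using h1
  · rw [rowLen_eq_zero lam (le_trans hlam (not_lt.1 hi)),
      rowLen_eq_zero nu (le_trans hnu (not_lt.1 hi))]

theorem exists_diagram (N : ℕ) (f : ℕ → ℕ) (hf : ∀ i j, i ≤ j → j < N → f j ≤ f i) :
    ∃ lam : YoungDiagram, lam.colLen 0 ≤ N ∧ ∀ i < N, lam.rowLen i = f i := by
  let lam : YoungDiagram :=
    { cells := (Finset.range N ×ˢ Finset.range (f 0)).filter fun c => c.2 < f c.1
      isLowerSet := by
        rintro ⟨i, j⟩ ⟨i', j'⟩ h hc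
        obtain ⟨hi, hj⟩ := Prod.mk_le_mk.1 h
        simp only [Finset.coe_filter, Finset.mem_product, Finset.mem_range,
          Set.mem_ofPred_eq] at hc ⊢
        have h1 := hf i' i hi hc.1.1
        omega }
  have hm : ∀ i j, (i, j) ∈ lam ↔ i < N ∧ j < f i := by
    intro i j
    change (i, j) ∈ (Finset.range N ×ˢ Finset.range (f 0)).filter _ ↔ _
    simp only [Finset.mem_filter, Finset.mem_product, Finset.mem_range]
    constructor
    · tauto
    · rintro ⟨h1, h2⟩
      exact ⟨⟨h1, h2.trans_le (hf 0 i (Nat.zero_le i) h1)⟩, h2⟩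
  refine ⟨lam, ?_, fun i hi => ?_⟩
  · by_contra! h
    have := (hm _ _).1 (YoungDiagram.mem_iff_lt_colLen.2 h)
    omega
  · refine eq_of_forall_lt_iff fun j => ?_
    rw [← YoungDiagram.mem_iff_lt_rowLen, hm]
    simp [hi]

theorem exists_shifted_eq (N : ℕ) (m : Fin N → ℕ) (hm : StrictMono m) :
    ∃ lam : YoungDiagram, lam.colLen 0 ≤ N ∧ shifted N lam = m := by
  -- A strictly increasing integer sequence gains at least 1 per step, so `m j - j` is weakly
  -- increasing and the truncated subtractions below are exact.
  have hmono : ∀ d (a b : Fin N), (b : ℕ) = a + d → m a + d ≤ m b := by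
    intro d
    induction d with
    | zero =>
      intro a b h
      rw [Fin.ext (h : (b : ℕ) = a)]
      omega
    | succ d ih =>
      intro a b h
      have h1 := ih a ⟨a + d, by omega⟩ rfl
      have h2 : m ⟨a + d, by omega⟩ < m b := hm (Fin.lt_def.2 (by simp; omega))
      omega
  obtain ⟨lam, h1, h2⟩ := exists_diagram N
    (fun i => if h : i < N then m ⟨N - 1 - i, by omega⟩ - (N - 1 - i) else 0) (by
      intro i j hij hj
      rw [dif_pos hj, dif_pos (hij.trans_lt hj)]
      have := hmono (j - i) ⟨N - 1 - j, by omega⟩ ⟨N - 1 - i, by omega⟩ (by simp; omega)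
      omega)
  refine ⟨lam, h1, funext fun j => ?_⟩
  have hj := j.isLt
  have h3 : (⟨N - 1 - (N - 1 - j), by omega⟩ : Fin N) = j := Fin.ext (by simp; omega)
  have h4 := hmono j ⟨0, by omega⟩ j (by simp)
  simp only [shifted]
  rw [h2 _ (by omega), dif_pos (by omega), h3]
  omega

theorem card_eq_sum_shifted {N : ℕ} {lam : YoungDiagram} (h : lam.colLen 0 ≤ N) :
    lam.card + ∑ j : Fin N, (j : ℕ) = ∑ j, shifted N lam j := by
  rw [card_eq_sum_rowLen lam h, ← Fin.sum_univ_eq_sum_range, ← Equiv.sum_comp Fin.revPerm,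
    ← Finset.sum_add_distrib]
  refine Finset.sum_congr rfl fun j _ => ?_
  simp only [Fin.revPerm_apply, Fin.val_rev, shifted]
  congr 2
  omega

/-- Passing from `N` to `N + 1` moves the staircase by one against the reversed row index, which
turns the upper bound `nu_i ≤ lam_i` into a strict one and leaves the lower bound weak. -/
theorem mem_interlacing_iff_shifted {N : ℕ} {lam nu : YoungDiagram} (hlam : lam.colLen 0 ≤ N + 1)
    (hnu : nu.colLen 0 ≤ N) :
    nu ∈ interlacing N lam ↔ ∀ j : Fin N, shifted N nu j ∈
      Finset.Ico (shifted (N + 1) lam j.castSucc) (shifted (N + 1) lam j.succ) := by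
  have he : ∀ j : Fin N, N + 1 - 1 - (j : ℕ) = N - 1 - j + 1 ∧
      N + 1 - 1 - ((j : ℕ) + 1) = N - 1 - j := fun j => by omega
  simp only [Finset.mem_Ico, shifted, Fin.val_castSucc, Fin.val_succ, he]
  constructor
  · intro h j
    have := h.2 (N - 1 - j)
    omega
  · intro h
    refine ⟨hnu, fun i => ?_⟩
    by_cases hi : i < N
    · have h1 := h ⟨N - 1 - i, by omega⟩
      have h2 : N - 1 - (N - 1 - i) = i := by omega
      simp only [h2] at h1
      omega
    · rw [rowLen_eq_zero nu (hnu.trans (not_lt.1 hi)),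
        rowLen_eq_zero lam (hlam.trans (Nat.succ_le_succ (not_lt.1 hi)))]
      omega

theorem alternant_shifted_succ {N : ℕ} {lam : YoungDiagram} (hlam : lam.colLen 0 ≤ N + 1) :
    alternant (N + 1) (shifted (N + 1) lam) =
      (∏ i : Fin N, (MvPolynomial.X N - MvPolynomial.X (i : ℕ))) *
        ∑ nu ∈ interlacingFinset N lam,
          alternant N (shifted N nu) * MvPolynomial.X N ^ (lam.card - nu.card) := by
  rw [alternant_succ _ _ (shifted_strictMono _ _)]
  congr 1
  symm
  refine Finset.sum_bij (fun nu _ => shifted N nu) ?_ ?_ ?_ ?_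
  · intro nu hnu
    rw [mem_interlacingFinset] at hnu
    exact Fintype.mem_piFinset.2 ((mem_interlacing_iff_shifted hlam hnu.1).1 hnu)
  · intro nu hnu nu' hnu' h
    rw [mem_interlacingFinset] at hnu hnu'
    exact shifted_injOn N hnu.1 hnu'.1 h
  · intro m hm
    rw [Fintype.mem_piFinset] at hm
    simp only [Finset.mem_Ico] at hm
    obtain ⟨nu, h1, h2⟩ := exists_shifted_eq N m (by
      intro a b hab
      exact ((hm a).2.trans_le ((shifted_strictMono _ lam).monotone (by
        rw [Fin.le_def]
        simpa using hab))).trans_le (hm b).1)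
    refine ⟨nu, ?_, h2⟩
    rw [mem_interlacingFinset, mem_interlacing_iff_shifted hlam h1, h2]
    simpa using hm
  · intro nu hnu
    rw [mem_interlacingFinset] at hnu
    have h1 := (mem_interlacing_iff_shifted hlam hnu.1).1 hnu
    simp only [Finset.mem_Ico] at h1
    congr 2
    -- Both exponents of `X N` agree: the staircase sums cancel from the total degrees, leaving
    -- `lam.card - nu.card`.
    have h2 := card_eq_sum_shifted hlam
    have h3 := card_eq_sum_shifted hnu.1
    have h4 : ∑ j : Fin N, (shifted (N + 1) lam j.succ - 1 - shifted N nu j) +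
        ∑ j, shifted N nu j + ∑ j : Fin N, 1 = ∑ j : Fin N, shifted (N + 1) lam j.succ := by
      rw [← Finset.sum_add_distrib, ← Finset.sum_add_distrib]
      refine Finset.sum_congr rfl fun j _ => ?_
      have := (h1 j).2
      omega
    rw [Fin.sum_univ_succ, Fin.sum_univ_succ] at h2
    simp only [Fin.val_zero, Fin.val_succ, Finset.sum_add_distrib] at h2
    omega

/-- For the staircase every interval `[j, j + 1)` is a single point, so the branching sum has one
term, with exponent 0. -/
theorem alternant_id_succ (N : ℕ) :
    alternant (N + 1) (fun j => (j : ℕ)) =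
      (∏ i : Fin N, (MvPolynomial.X N - MvPolynomial.X (i : ℕ))) *
        alternant N (fun j => (j : ℕ)) := by
  rw [alternant_succ _ _ Fin.val_strictMono]
  congr 1
  rw [Finset.sum_eq_single_of_mem (fun j : Fin N => (j : ℕ))]
  · simp
  · simp
  · intro m hm h
    refine absurd (funext fun j => ?_) h
    have := Fintype.mem_piFinset.1 hm j
    simp only [Finset.mem_Ico, Fin.val_castSucc, Fin.val_succ] at this
    omega

/-! ### The bialternant formula -/

/-- The bialternant formula for Schur polynomials. -/
theorem tableauSum_mul_alternant (N : ℕ) (lam : YoungDiagram) (hlam : lam.colLen 0 ≤ N) :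
    tableauSum N lam * alternant N (fun j => (j : ℕ)) = alternant N (shifted N lam) := by
  induction N generalizing lam with
  | zero =>
    rw [tableauSum_zero lam hlam]
    simp [alternant]
  | succ N ih =>
    rw [alternant_shifted_succ hlam, alternant_id_succ, tableauSum_succ, Finset.sum_mul,
      Finset.mul_sum]
    refine Finset.sum_congr rfl fun nu hnu => ?_
    rw [mem_interlacingFinset] at hnu
    rw [← ih nu hnu.1]
    ring

theorem alternant_comp_perm (N : ℕ) (l : Fin N → ℕ) (σ : Equiv.Perm (Fin N)) :
    alternant N (l ∘ σ) = (σ.sign : ℤ) * alternant N l := by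
  have h := Matrix.det_permute' σ
    (Matrix.of fun i j : Fin N => (MvPolynomial.X (i : ℕ) : MvPolynomial ℕ ℤ) ^ l j)
  exact h

theorem alternant_eq_zero {N : ℕ} {l : Fin N → ℕ} (hl : ¬ Function.Injective l) :
    alternant N l = 0 := by
  obtain ⟨i, j, hij, hne⟩ := Function.not_injective_iff.1 hl
  exact Matrix.det_zero_of_column_eq hne fun a => by simp [hij]

/-! ### Multiplying alternants by the Petrie polynomial -/

/-- Collecting the terms of a sum of alternants by their sorted exponents. -/
theorem sum_mul_alternant (N M : ℕ) (g : (Fin N → ℕ) → ℤ) :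
    ∑ f ∈ Fintype.piFinset (fun _ : Fin N => Finset.range M), (g f : MvPolynomial ℕ ℤ) *
        alternant N f =
      ∑ l ∈ (Fintype.piFinset (fun _ : Fin N => Finset.range M)).filter StrictMono,
        ((∑ σ : Equiv.Perm (Fin N), (σ.sign : ℤ) * g (l ∘ σ) : ℤ) : MvPolynomial ℕ ℤ) *
          alternant N l := by
  classical
  rw [← Finset.sum_subset (Finset.filter_subset Function.Injective _)]
  · simp only [Int.cast_sum, Finset.sum_mul]
    rw [← Finset.sum_product']
    symm
    refine Finset.sum_bij (fun p _ => p.1 ∘ p.2) ?_ ?_ ?_ ?_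
    · rintro ⟨l, σ⟩ h
      simp only [Finset.mem_product, Finset.mem_filter, Fintype.mem_piFinset] at h ⊢
      exact ⟨fun i => h.1.1 _, h.1.2.injective.comp σ.injective⟩
    · rintro ⟨l, σ⟩ h ⟨l', σ'⟩ h' heq
      simp only [Finset.mem_product, Finset.mem_filter] at h h' heq
      have e1 : (l ∘ σ) ∘ (σ⁻¹ : Equiv.Perm (Fin N)) = l := by ext i; simp
      have e2 : (l ∘ σ) ∘ (σ'⁻¹ : Equiv.Perm (Fin N)) = l' := by rw [heq]; ext i; simp
      have e3 : l = l' := by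
        -- The sorted rearrangement of a sequence is unique, which recovers `l`; injectivity of `l`
        -- then recovers the permutation.
        have := Tuple.unique_monotone (f := l ∘ σ) (σ := σ⁻¹) (τ := σ'⁻¹)
          (by rw [e1]; exact h.1.2.monotone) (by rw [e2]; exact h'.1.2.monotone)
        rwa [e1, e2] at this
      subst e3
      exact Prod.ext rfl (Equiv.ext fun i => h.1.2.injective (congrFun heq i))
    · intro f hf
      simp only [Finset.mem_filter, Fintype.mem_piFinset] at hf
      refine ⟨(f ∘ Tuple.sort f, (Tuple.sort f)⁻¹), ?_, by ext i; simp⟩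
      simp only [Finset.mem_product, Finset.mem_filter, Fintype.mem_piFinset, Finset.mem_univ,
        and_true]
      exact ⟨fun i => hf.1 _, (Tuple.monotone_sort f).strictMono_of_injective
        (hf.2.comp (Tuple.sort f).injective)⟩
    · rintro ⟨l, σ⟩ _
      simp only [alternant_comp_perm]
      push_cast
      ring
  · intro f h1 h2
    rw [alternant_eq_zero (fun h => h2 (Finset.mem_filter.2 ⟨h1, h⟩)), mul_zero]

/-- The product of the polynomials `1 + x_i + ⋯ + x_i ^ (k - 1)` over the first `N` variables. -/
noncomputable def petriePoly (k N : ℕ) : MvPolynomial ℕ ℤ :=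
  ∏ i : Fin N, ∑ r ∈ Finset.range k, MvPolynomial.X (i : ℕ) ^ r

/-- The `i`-th factor scales row `i`. The bound `hm` makes `range M` contain all exponents that
arise; after sorting, the signed sum over permutations is the Leibniz expansion of the displayed
determinant. -/
theorem petriePoly_mul_alternant (k N M : ℕ) (m : Fin N → ℕ) (hm : ∀ j, m j + k ≤ M) :
    petriePoly k N * alternant N m =
      ∑ l ∈ (Fintype.piFinset (fun _ : Fin N => Finset.range M)).filter StrictMono,
        (((Matrix.of fun i j => if m j ≤ l i ∧ l i < m j + k then 1 else 0 :
          Matrix (Fin N) (Fin N) ℤ).det : ℤ) : MvPolynomial ℕ ℤ) * alternant N l := by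
  have h1 : ∀ i j : Fin N,
      (∑ r ∈ Finset.range k, (MvPolynomial.X (i : ℕ) : MvPolynomial ℕ ℤ) ^ r) *
        MvPolynomial.X (i : ℕ) ^ m j = ∑ a ∈ Finset.range M,
          (((if m j ≤ a ∧ a < m j + k then 1 else 0 : ℤ)) : MvPolynomial ℕ ℤ) *
            MvPolynomial.X (i : ℕ) ^ a := by
    intro i j
    simp only [Int.cast_ite, Int.cast_one, Int.cast_zero, ite_mul, one_mul, zero_mul]
    rw [← Finset.sum_filter]
    have h2 : (Finset.range M).filter (fun a => m j ≤ a ∧ a < m j + k) =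
        Finset.Ico (m j) (m j + k) := by
      ext a
      have := hm j
      simp only [Finset.mem_filter, Finset.mem_range, Finset.mem_Ico]
      omega
    rw [h2, Finset.sum_Ico_eq_sum_range, Finset.sum_mul, Nat.add_sub_cancel_left]
    exact Finset.sum_congr rfl fun r _ => by ring
  have h3 : petriePoly k N * alternant N m =
      ∑ f ∈ Fintype.piFinset (fun _ : Fin N => Finset.range M),
        ((∏ j, if m j ≤ f j ∧ f j < m j + k then 1 else 0 : ℤ) : MvPolynomial ℕ ℤ) *
          alternant N f := by
    unfold petriePoly alternant
    rw [← Matrix.det_mul_column]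
    simp only [Matrix.of_apply, h1]
    rw [det_sum_col _
      (fun (j : Fin N) a => (((if m j ≤ a ∧ a < m j + k then 1 else 0 : ℤ)) : MvPolynomial ℕ ℤ))
      (fun (i : Fin N) a => MvPolynomial.X (i : ℕ) ^ a)]
    simp only [Int.cast_prod]
  rw [h3, sum_mul_alternant N M (fun f => ∏ j, if m j ≤ f j ∧ f j < m j + k then 1 else 0)]
  refine Finset.sum_congr rfl fun l _ => ?_
  rw [Matrix.det_apply]
  simp [Units.smul_def]

/-- Reversing rows and columns simultaneously preserves the determinant, and the difference of the
two staircases is the term `-i + j`. -/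
theorem petrieNumber_eq_det_shifted (k : ℕ) (hk : 0 < k) {lam mu : YoungDiagram} {N : ℕ}
    (hlam : lam.colLen 0 ≤ N) (hmu : mu.colLen 0 ≤ N) :
    petrieNumber k lam mu = (Matrix.of fun i j =>
      if shifted N mu j ≤ shifted N lam i ∧ shifted N lam i < shifted N mu j + k then 1 else 0 :
        Matrix (Fin N) (Fin N) ℤ).det := by
  rw [petrieNumber_eq_det k hk lam mu N hlam hmu, ← Matrix.det_submatrix_equiv_self Fin.revPerm]
  congr 1
  ext1 i j
  have e : ∀ i : Fin N, N - (i + 1) = N - 1 - (i : ℕ) := fun i => by omega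
  simp only [petrieMatrix, Matrix.submatrix_apply, Fin.revPerm_apply, Fin.val_rev, Matrix.of_apply,
    shifted, e]
  have hi := i.isLt
  have hj := j.isLt
  refine if_congr ?_ rfl rfl
  omega

/-- The partitions with at most `N` parts and largest shifted part less than `M`. -/
def box (N M : ℕ) : Set YoungDiagram :=
  {lam | lam.colLen 0 ≤ N ∧ ∀ j, shifted N lam j < M}

theorem finite_box (N M : ℕ) : (box N M).Finite := by
  refine Set.Finite.of_finite_image (f := shifted N) ?_
    ((shifted_injOn N).mono fun lam h => h.1)
  refine Set.Finite.subset
    (Finset.finite_toSet (Fintype.piFinset fun _ : Fin N => Finset.range M)) ?_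
  rintro _ ⟨lam, hlam, rfl⟩
  simpa using hlam.2

theorem petriePoly_mul_tableauSum (k : ℕ) (hk : 0 < k) (N M : ℕ) (mu : YoungDiagram)
    (hmu : mu.colLen 0 ≤ N) (hM : ∀ j, shifted N mu j + k ≤ M) :
    petriePoly k N * tableauSum N mu =
      ∑ lam ∈ (finite_box N M).toFinset, petrieNumber k lam mu • tableauSum N lam := by
  apply mul_right_cancel₀ (alternant_ne_zero N)
  rw [mul_assoc, tableauSum_mul_alternant N mu hmu, petriePoly_mul_alternant k N M _ hM,
    Finset.sum_mul]
  symm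
  refine Finset.sum_bij (fun lam _ => shifted N lam) ?_ ?_ ?_ ?_
  · intro lam hlam
    rw [Set.Finite.mem_toFinset] at hlam
    simpa [shifted_strictMono] using hlam.2
  · intro lam hlam nu hnu h
    rw [Set.Finite.mem_toFinset] at hlam hnu
    exact shifted_injOn N hlam.1 hnu.1 h
  · intro l hl
    rw [Finset.mem_filter, Fintype.mem_piFinset] at hl
    obtain ⟨lam, h1, rfl⟩ := exists_shifted_eq N l hl.2
    exact ⟨lam, by simpa [box, h1] using hl.1, rfl⟩
  · intro lam hlam
    rw [Set.Finite.mem_toFinset] at hlam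
    rw [smul_mul_assoc, tableauSum_mul_alternant N lam hlam.1,
      petrieNumber_eq_det_shifted k hk hlam.1 hmu, zsmul_eq_mul]

/-! ### Coefficients in infinitely many variables -/

theorem coeff_petriePoly (k : ℕ) (hk : 0 < k) (N : ℕ) (β : ℕ →₀ ℕ) :
    (petriePoly k N).coeff β =
      open Classical in if (∀ i, N ≤ i → β i = 0) ∧ ∀ i, β i < k then 1 else 0 := by
  classical
  unfold petriePoly
  rw [Fin.prod_univ_eq_prod_range
    (fun i => ∑ r ∈ Finset.range k, (MvPolynomial.X i : MvPolynomial ℕ ℤ) ^ r)]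
  induction N generalizing β with
  | zero =>
    rw [Finset.prod_range_zero, MvPolynomial.coeff_one]
    refine if_congr ⟨?_, ?_⟩ rfl rfl
    · rintro rfl
      simpa using hk
    · rintro ⟨h, _⟩
      ext i
      simp [h i]
  | succ N ih =>
    rw [Finset.prod_range_succ, Finset.mul_sum, MvPolynomial.coeff_sum]
    have hstep : ∀ r, ((∏ i ∈ Finset.range N, ∑ r ∈ Finset.range k,
        (MvPolynomial.X i : MvPolynomial ℕ ℤ) ^ r) * MvPolynomial.X N ^ r).coeff β =
        if r ≤ β N ∧ (∀ i, N ≤ i → (β - Finsupp.single N r) i = 0) ∧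
          ∀ i, (β - Finsupp.single N r) i < k then 1 else 0 := fun r => by
      rw [MvPolynomial.X_pow_eq_monomial, MvPolynomial.coeff_mul_monomial', mul_one, ih]
      simp only [Finsupp.single_le_iff, ite_and]
    simp only [hstep]
    -- Only the power `r = β N` uses up the variable `X N` completely.
    have key : ∀ r ∈ Finset.range k,
        ((r ≤ β N ∧ (∀ i, N ≤ i → (β - Finsupp.single N r) i = 0) ∧
          ∀ i, (β - Finsupp.single N r) i < k) ↔
        r = β N ∧ (∀ i, N + 1 ≤ i → β i = 0) ∧ ∀ i, β i < k) := by
      intro r hr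
      rw [Finset.mem_range] at hr
      constructor
      · rintro ⟨h1, h2, h3⟩
        have h4 : r = β N := by
          have := h2 N le_rfl
          simp at this
          omega
        refine ⟨h4, fun i hi => ?_, fun i => ?_⟩
        · have := h2 i (by omega)
          rwa [Finsupp.tsub_apply, Finsupp.single_eq_of_ne (by omega), Nat.sub_zero] at this
        · by_cases hi : i = N
          · subst hi; omega
          · have := h3 i
            rwa [Finsupp.tsub_apply, Finsupp.single_eq_of_ne (by omega), Nat.sub_zero] at this
      · rintro ⟨rfl, h2, h3⟩
        refine ⟨le_rfl, fun i hi => ?_, fun i => lt_of_le_of_lt ?_ (h3 i)⟩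
        · by_cases h : i = N
          · subst h; simp
          · simp [h2 i (by omega)]
        · simp
    rw [Finset.sum_congr rfl fun r hr => if_congr (key r hr) rfl rfl]
    simp only [ite_and]
    rw [Finset.sum_ite_eq']
    by_cases h : β N < k
    · simp [h]
    · rw [if_neg (by simpa using h)]
      have : ¬ ∀ i, β i < k := fun h' => h (h' N)
      simp [this]

theorem schur_coeff_eq_zero {R : Type*} [CommRing R] {lam : YoungDiagram} {α : ℕ →₀ ℕ}
    (h : lam.card ≠ α.degree) : MvPowerSeries.coeff α (schur R lam) = 0 := by
  change (Nat.card {T : SemistandardYoungTableau lam // content T = α} : R) = 0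
  have : IsEmpty {T : SemistandardYoungTableau lam // content T = α} :=
    ⟨fun T => h (by rw [← T.2, degree_content])⟩
  rw [Nat.card_of_isEmpty, Nat.cast_zero]

theorem intCast_coeff_tableauSum {R : Type*} [CommRing R] {N : ℕ} (lam : YoungDiagram)
    {α : ℕ →₀ ℕ} (hα : α.support ⊆ Finset.range N) :
    (((tableauSum N lam).coeff α : ℤ) : R) = MvPowerSeries.coeff α (schur R lam) := by
  rw [coeff_tableauSum lam hα, Int.cast_natCast]
  rfl

theorem colLen_le_card (lam : YoungDiagram) : lam.colLen 0 ≤ lam.card := by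
  rw [YoungDiagram.colLen_eq_card]
  exact Finset.card_le_card (Finset.filter_subset _ _)

theorem rowLen_le_card (lam : YoungDiagram) (i : ℕ) : lam.rowLen i ≤ lam.card := by
  rw [YoungDiagram.rowLen_eq_card]
  exact Finset.card_le_card (Finset.filter_subset _ _)

theorem coeff_petrieSeries_mul_schur (R : Type*) [CommRing R] (k : ℕ) (hk : 0 < k)
    (mu : YoungDiagram) (α : ℕ →₀ ℕ) :
    MvPowerSeries.coeff α (petrieSeries R k * schur R mu) =
      ∑ lam ∈ partitionsOfSize α.degree,
        MvPowerSeries.coeff α (petrieNumber k lam mu • schur R lam) := by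
  classical
  -- `N` covers the variables of `α`, the rows of `mu`, and the rows of every partition of size
  -- `α.degree`.
  obtain ⟨N, hα, hmu, hN⟩ : ∃ N, α.support ⊆ Finset.range N ∧ mu.colLen 0 ≤ N ∧
      α.degree ≤ N := by
    refine ⟨α.support.sup id + 1 + mu.colLen 0 + α.degree, fun i hi => ?_, by omega, by omega⟩
    have : i ≤ α.support.sup id := Finset.le_sup (f := id) hi
    rw [Finset.mem_range]
    omega
  -- This bound leaves room for the shifted parts of `mu` plus `k`, and for every partition of size
  -- `α.degree` to lie in the box.
  have hM : ∀ j, shifted N mu j + k ≤ mu.card + α.degree + N + k := fun j => by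
    have := rowLen_le_card mu (N - 1 - j)
    have := j.isLt
    simp only [shifted]
    omega
  have key := congrArg (fun p => ((p.coeff α : ℤ) : R))
    (petriePoly_mul_tableauSum k hk N _ mu hmu hM)
  have hL : (((petriePoly k N * tableauSum N mu).coeff α : ℤ) : R) =
      MvPowerSeries.coeff α (petrieSeries R k * schur R mu) := by
    rw [MvPolynomial.coeff_mul, MvPowerSeries.coeff_mul, Int.cast_sum]
    refine Finset.sum_congr rfl ?_
    rintro ⟨β, γ⟩ h
    rw [Finset.HasAntidiagonal.mem_antidiagonal] at h
    have hβ : β ≤ α := h ▸ le_self_add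
    have hγ : γ ≤ α := h ▸ le_add_self
    rw [Int.cast_mul, intCast_coeff_tableauSum mu ((Finsupp.support_mono hγ).trans hα),
      coeff_petriePoly k hk]
    congr 1
    have h0 : ∀ i, N ≤ i → β i = 0 := fun i hi => by
      by_contra h0
      have := hα (Finsupp.support_mono hβ (Finsupp.mem_support_iff.2 h0))
      rw [Finset.mem_range] at this
      omega
    change _ = (if ∀ i, β i < k then (1 : R) else 0)
    by_cases h : ∀ i, β i < k
    · rw [if_pos ⟨h0, h⟩, if_pos h, Int.cast_one]
    · rw [if_neg (fun h' => h h'.2), if_neg h, Int.cast_zero]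
  simp only [hL, MvPolynomial.coeff_sum, Int.cast_sum] at key
  rw [key]
  have hterm : ∀ lam : YoungDiagram,
      (((petrieNumber k lam mu • tableauSum N lam).coeff α : ℤ) : R) =
        MvPowerSeries.coeff α (petrieNumber k lam mu • schur R lam) := fun lam => by
    rw [map_zsmul, ← intCast_coeff_tableauSum lam hα, MvPolynomial.coeff_smul, smul_eq_mul,
      Int.cast_mul, zsmul_eq_mul]
  simp only [hterm]
  symm
  refine Finset.sum_subset ?_ ?_
  · intro lam hlam
    rw [mem_partitionsOfSize] at hlam
    rw [Set.Finite.mem_toFinset]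
    refine ⟨(colLen_le_card lam).trans (hlam.le.trans hN), fun j => ?_⟩
    have := rowLen_le_card lam (N - 1 - j)
    have := j.isLt
    simp only [shifted]
    omega
  · intro lam _ hlam
    rw [mem_partitionsOfSize] at hlam
    rw [map_zsmul, schur_coeff_eq_zero hlam, smul_zero]

/-- Since `schur R mu` is homogeneous of degree `mu.card`, fixing the degree of the first factor
amounts to fixing that of the product. -/
theorem coeff_petrieFunction_mul_schur (R : Type*) [CommRing R] (k m : ℕ) (mu : YoungDiagram)
    (α : ℕ →₀ ℕ) :
    MvPowerSeries.coeff α (petrieFunction R k m * schur R mu) =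
      if α.degree = m + mu.card then
        MvPowerSeries.coeff α (petrieSeries R k * schur R mu) else 0 := by
  classical
  rw [MvPowerSeries.coeff_mul, MvPowerSeries.coeff_mul]
  have key : ∀ p ∈ Finset.HasAntidiagonal.antidiagonal α,
      MvPowerSeries.coeff p.1 (petrieFunction R k m) * MvPowerSeries.coeff p.2 (schur R mu) =
        if α.degree = m + mu.card then MvPowerSeries.coeff p.1 (petrieSeries R k) *
          MvPowerSeries.coeff p.2 (schur R mu) else 0 := by
    rintro ⟨β, γ⟩ h
    rw [Finset.HasAntidiagonal.mem_antidiagonal] at h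
    by_cases hγ : mu.card = γ.degree
    · have hd : β.degree = m ↔ α.degree = m + mu.card := by
        rw [← h, map_add, hγ, add_left_inj]
      change (if β.degree = m ∧ ∀ i, β i < k then (1 : R) else 0) * _ =
        if α.degree = m + mu.card then (if ∀ i, β i < k then (1 : R) else 0) * _ else 0
      rw [ite_and, ite_mul, zero_mul]
      exact if_congr hd rfl rfl
    · simp [schur_coeff_eq_zero hγ]
  rw [Finset.sum_congr rfl key]
  split_ifs <;> simp

end Petrie

/-- Infinite sums in `R[[x₁, x₂, x₃, …]]` are taken coefficientwise, with `R` discrete. -/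
theorem mainTheorem1 (R : Type*) [CommRing R] (k : ℕ) (hk : 0 < k) (mu : YoungDiagram) :
    (letI : TopologicalSpace R := ⊥;
      HasSum (fun lam : YoungDiagram => Petrie.petrieNumber k lam mu • Petrie.schur R lam)
        (Petrie.petrieSeries R k * Petrie.schur R mu)) ∧
    ∀ m : ℕ, Petrie.petrieFunction R k m * Petrie.schur R mu =
      ∑ lam ∈ Petrie.partitionsOfSize (m + mu.card),
        Petrie.petrieNumber k lam mu • Petrie.schur R lam := by
  have hzero : ∀ (α : ℕ →₀ ℕ) (lam : YoungDiagram), lam.card ≠ α.degree →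
      MvPowerSeries.coeff α (Petrie.petrieNumber k lam mu • Petrie.schur R lam) = 0 := by
    intro α lam h
    rw [map_zsmul, Petrie.schur_coeff_eq_zero h, smul_zero]
  constructor
  · let _ : TopologicalSpace R := ⊥
    rw [MvPowerSeries.WithPiTopology.hasSum_iff_hasSum_coeff]
    intro α
    rw [Petrie.coeff_petrieSeries_mul_schur R k hk]
    -- For a fixed monomial only partitions of its degree contribute, so the sum is finite.
    refine hasSum_sum_of_ne_finset_zero fun lam h => hzero α lam ?_
    rwa [Petrie.mem_partitionsOfSize] at h
  · intro m
    ext α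
    rw [Petrie.coeff_petrieFunction_mul_schur, map_sum]
    split_ifs with h
    · rw [Petrie.coeff_petrieSeries_mul_schur R k hk, h]
    · refine (Finset.sum_eq_zero fun lam hlam => hzero α lam ?_).symm
      rw [Petrie.mem_partitionsOfSize] at hlam
      rw [hlam]
      exact Ne.symm h
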